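/- Let $n\ge 1$ and let $\mathfrak S_n$ be the symmetric group on $\{1,\dots,n\}$. For $\sigma\in\mathfrak S_n$ let $\ell(\sigma)$ be the number of cycles of $\sigma$ (fixed points included) and $|\sigma|=n-\ell(\sigma)$. The Cayley graph of $\mathfrak S_n$ generated by all transpositions has vertex set $\mathfrak S_n$, with $\sigma_1,\sigma_2$ adjacent if and only if $\sigma_1\sigma_2^{-1}$ is a transposition. A path of length $k$ is a sequence $(\sigma_0,\dots,\sigma_k)$ of permutations in which $\sigma_i$ and $\sigma_{i+1}$ are adjacent for $0\le i<k$; its defect is the number of indices $i\in\{0,\dots,k-1\}$ with $|\sigma_{i+1}|=|\sigma_i|+1$. For integers $k,d\ge 0$ let $S(\sigma,k,d)$ be the number of paths of length $k$ and defect $d$ starting at $\sigma$. Let ${N \brack j}$ denote the (signed) Stirling numbers of the first kind, defined for $N\ge 0$ by $x(x-1)\cdots(x-N+1)=\sum_{j=0}^{N}{N\brack j}x^j$, with ${N\brack j}=0$ if $j<0$ or $j>N$. **Proposition.** For all integers $n\ge 1$ and $k,d\ge 0$, $$S\big((1\,2\ldots n),k,d\big)=\frac1n\sum_{\substack{r,s,l,m\ge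 0\\ r+s=n-1\\ l+m=n-1-k+2d}}\frac{(-1)^{l+r}}{r!\,s!}\Big(\frac n2(s-r)\Big)^k{s+1\brack s+1-l}{r+1\brack r+1-m},$$ where $0^0=1$ and the sum is empty (hence $0$) if $n-1-k+2d<0$. -/

import Mathlib

open Finset

/-- The number `ℓ(σ)` of cycles of a permutation of `{1, …, n}` (modelled as `Fin n`), fixed points
being counted as cycles of length one. -/
def cycleCount {n : ℕ} (σ : Equiv.Perm (Fin n)) : ℕ :=
  Multiset.card σ.partition.parts

/-- There are at most `n` cycles, so the subtraction in `permLength` is a true one. -/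
theorem cycleCount_le {n : ℕ} (σ : Equiv.Perm (Fin n)) : cycleCount σ ≤ n := by
  have h := Multiset.card_nsmul_le_sum (s := σ.partition.parts) (a := 1)
    (fun x hx => σ.partition.parts_pos hx)
  have h' := (h.trans_eq σ.partition.parts_sum).trans_eq (Fintype.card_fin n)
  simpa [cycleCount] using h'

/-- `|σ| = n - ℓ(σ)`, the distance from `σ` to the identity in the Cayley graph. -/
def permLength {n : ℕ} (σ : Equiv.Perm (Fin n)) : ℕ :=
  n - cycleCount σ

/-- The Cayley graph of the symmetric group generated by all transpositions. -/
def transpositionGraph (n : ℕ) : SimpleGraph (Equiv.Perm (Fin n)) where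
  Adj σ₁ σ₂ := (σ₁ * σ₂⁻¹).IsSwap
  symm := ⟨by
    rintro σ₁ σ₂ ⟨x, y, hxy, h⟩
    refine ⟨x, y, hxy, ?_⟩
    rw [← Equiv.swap_inv, ← h, mul_inv_rev, inv_inv]⟩
  loopless := ⟨by
    rintro σ ⟨x, y, hxy, h⟩
    rw [mul_inv_cancel] at h
    exact hxy (Equiv.swap_eq_one_iff.mp h.symm)⟩

/-- `γ = (γ 0, …, γ k)` is a path of length `k` in the Cayley graph, starting at `σ`. -/
def IsPathFrom {n k : ℕ} (σ : Equiv.Perm (Fin n)) (γ : Fin (k + 1) → Equiv.Perm (Fin n)) : Prop :=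
  γ 0 = σ ∧ ∀ i : Fin k, (transpositionGraph n).Adj (γ i.castSucc) (γ i.succ)

/-- The defect of a path: the number of steps which increase the distance to the identity. -/
def pathDefect {n k : ℕ} (γ : Fin (k + 1) → Equiv.Perm (Fin n)) : ℕ :=
  #{i : Fin k | permLength (γ i.succ) = permLength (γ i.castSucc) + 1}

/-- `S(σ, k, d)`: the number of paths in the Cayley graph which start at `σ` and have length `k` and
defect `d`. -/
noncomputable def pathCount {n : ℕ} (σ : Equiv.Perm (Fin n)) (k d : ℕ) : ℕ :=
  Nat.card {γ : Fin (k + 1) → Equiv.Perm (Fin n) // IsPathFrom σ γ ∧ pathDefect γ = d}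

/-- The signed Stirling numbers of the first kind: the coefficient of `x ^ j` in
`x (x - 1) ⋯ (x - n + 1)`, with value `0` for `j < 0`. -/
noncomputable def signedStirlingFirst (n : ℕ) (j : ℤ) : ℤ :=
  if j < 0 then 0 else (descPochhammer ℤ n).coeff j.toNat

/-! Write n = m + 1. Each step of a path changes the number of cycles by exactly one, so the defect
is determined by the endpoint (`cycleCount_last_add_two_mul_pathDefect`), and it suffices to compute
the sum of x^ℓ(endpoint) over walks of length k from an n-cycle.

This is Fourier analysis on hook characters, done with determinants instead of representations. Let
P be the permutation matrix of σ and H_σ(q) = det(1 + qP)/(1 + q). Multiplying σ by a transposition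
changes 1 + qP by a rank-one matrix. Summing the determinant lemma over all transpositions leaves
only traces and row sums, so the coefficient of q^r in H is an eigenfunction of the adjacency
operator, with eigenvalue n(s - r)/2 where s = m - r (`two_mul_transpositionSum_hookPoly`,
`coeff_contentOp`).

At q = -1, H vanishes off the n-cycles, so pairing H(-1) with a class function returns n! times its
value at an n-cycle (`sum_hookPoly_eval_mul_of_conj`). By self-adjointness the k steps of the walk
can be moved onto H. What remains is the pairing of H with x^ℓ(σ), found by inserting one point at a
time: after multiplication by x, its q^r coefficient is a binomial times a rising and a falling
factorial (`coeff_C_mul_sum_hookPoly`). Extracting a power of x yields the Stirling numbers. -/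

open Polynomial Matrix in
/-- The matrix determinant lemma over a domain, without inverses. -/
theorem det_add_vecMulVec_eq {ι K : Type*} [Fintype ι] [DecidableEq ι] [CommRing K] [IsDomain K]
    (A : Matrix ι ι K) (hA : A.det ≠ 0) (u v : ι → K) :
    (A + vecMulVec u v).det = A.det + v ⬝ᵥ (A.adjugate *ᵥ u) := by
  have hinj : Function.Injective (algebraMap K (FractionRing K)) :=
    FaithfulSMul.algebraMap_injective _ _
  set f := algebraMap K (FractionRing K) with hf
  have hu : IsUnit (A.map f).det := by
    rw [← RingHom.mapMatrix_apply, ← RingHom.map_det, isUnit_iff_ne_zero]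
    exact fun h => hA (hinj (by rw [h, map_zero]))
  apply hinj
  have key := det_add_replicateCol_mul_replicateRow (ι := Unit) hu (f ∘ u) (f ∘ v)
  have e1 : f (A + vecMulVec u v).det
      = (A.map f + replicateCol Unit (f ∘ u) * replicateRow Unit (f ∘ v)).det := by
    rw [RingHom.map_det]
    congr 1
    ext i j
    simp [vecMulVec_apply, Matrix.mul_apply]
  rw [e1, key, det_unique (n := Unit), Matrix.add_apply, map_add, RingHom.map_det,
    RingHom.mapMatrix_apply, mul_add,
    Matrix.inv_def, Ring.inverse_eq_inv', Matrix.mul_smul, Matrix.smul_mul]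
  have h0 : (A.map f).det ≠ 0 := hu.ne_zero
  have e2 : (replicateRow Unit (f ∘ v) * (A.map f).adjugate * replicateCol Unit (f ∘ u))
      default default = f (v ⬝ᵥ (A.adjugate *ᵥ u)) := by
    rw [Matrix.mul_assoc, ← RingHom.mapMatrix_apply, ← RingHom.map_adjugate]
    simp [Matrix.mul_apply, dotProduct, mulVec]
  simp only [Matrix.smul_apply, e2, Matrix.one_apply_eq, smul_eq_mul]
  field_simp

open Polynomial Matrix in
/-- Jacobi's formula for a matrix of polynomials. -/
theorem derivative_det_eq_trace {ι K : Type*} [Fintype ι] [DecidableEq ι] [CommRing K]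
    (A : Matrix ι ι K[X]) :
    derivative A.det = (A.adjugate * A.map derivative).trace := by
  have h : ∀ i, (A.adjugate * A.map derivative) i i
      = (A.updateCol i (fun j => derivative (A j i))).det := by
    intro i
    rw [← cramer_apply, cramer_eq_adjugate_mulVec]
    simp [Matrix.mul_apply, mulVec, dotProduct]
  simp only [Matrix.trace, Matrix.diag_apply, h, det_apply]
  rw [Finset.sum_comm, derivative_sum]
  refine Finset.sum_congr rfl fun σ _ => ?_
  rw [← Finset.smul_sum]
  rw [show derivative (Equiv.Perm.sign σ • ∏ i, A (σ i) i)
      = Equiv.Perm.sign σ • derivative (∏ i, A (σ i) i) by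
    rcases Int.units_eq_one_or (Equiv.Perm.sign σ) with h | h <;> simp [h]]
  congr 1
  rw [derivative_prod_finset]
  refine Finset.sum_congr rfl fun i _ => ?_
  rw [← Finset.mul_prod_erase _ _ (Finset.mem_univ i), mul_comm]
  congr 1
  · simp
  · refine Finset.prod_congr rfl fun j hj => ?_
    rw [updateCol_ne (Finset.ne_of_mem_erase hj)]

theorem permMatrix_entry {ι R : Type*} [DecidableEq ι] [Zero R] [One R] (σ : Equiv.Perm ι)
    (i j : ι) : σ.permMatrix R i j = if σ i = j then 1 else 0 := by
  simp only [PEquiv.toMatrix_apply, Equiv.toPEquiv_apply, Option.mem_some_iff]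

/-! ### The pencil 1 + qP and its behaviour under transpositions. -/

section PermDet
open Polynomial Matrix

variable {ι : Type*} [DecidableEq ι] (R : Type*) [CommRing R]

/-- The matrix `1 + q P` for a permutation matrix `P`, over the polynomial ring in `q`. -/
noncomputable def permPencil (σ : Equiv.Perm ι) : Matrix ι ι R[X] :=
  1 + (X : R[X]) • σ.permMatrix R[X]

theorem permPencil_apply (σ : Equiv.Perm ι) (i j : ι) :
    permPencil R σ i j = (if i = j then 1 else 0) + X * (if σ i = j then 1 else 0) := by
  rw [permPencil, Matrix.add_apply, Matrix.smul_apply, permMatrix_entry, Matrix.one_apply,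
    smul_eq_mul]

theorem permPencil_map_derivative (σ : Equiv.Perm ι) :
    (permPencil R σ).map derivative = σ.permMatrix R[X] := by
  ext1 i j
  rw [Matrix.map_apply, permPencil, Matrix.add_apply, Matrix.smul_apply, permMatrix_entry,
    Matrix.one_apply]
  split_ifs <;> simp

theorem permMatrix_swap (i j : ι) : (Equiv.swap i j).permMatrix R
    = 1 - vecMulVec (Pi.single i 1 - Pi.single j 1 : ι → R) (Pi.single i 1 - Pi.single j 1) := by
  ext a b
  simp only [permMatrix_entry, Matrix.sub_apply,
    Matrix.one_apply, vecMulVec_apply, Pi.sub_apply, Pi.single_apply, Equiv.swap_apply_def]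
  split_ifs <;> grind

variable [Fintype ι]

/-- The matrix `adj (1 + q P) P`. -/
noncomputable def permPencilAdj (σ : Equiv.Perm ι) : Matrix ι ι R[X] :=
  (permPencil R σ).adjugate * σ.permMatrix R[X]

theorem permPencil_det_ne_zero [Nontrivial R] (σ : Equiv.Perm ι) : (permPencil R σ).det ≠ 0 := by
  intro h
  have h2 := congrArg (Polynomial.evalRingHom (0 : R)) h
  rw [RingHom.map_det] at h2
  have : (Polynomial.evalRingHom (0 : R)).mapMatrix (permPencil R σ) = 1 := by
    ext i j
    rw [RingHom.mapMatrix_apply, Matrix.map_apply, permPencil, Matrix.add_apply, Matrix.smul_apply,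
      smul_eq_mul, map_add, map_mul, coe_evalRingHom, eval_X, zero_mul, add_zero, Matrix.one_apply,
      Matrix.one_apply]
    split_ifs <;> simp
  rw [this] at h2
  simp at h2

theorem derivative_permPencil_det (σ : Equiv.Perm ι) :
    derivative (permPencil R σ).det = (permPencilAdj R σ).trace := by
  rw [derivative_det_eq_trace, permPencil_map_derivative, permPencilAdj]

theorem permPencil_swap_mul (σ : Equiv.Perm ι) (i j : ι) :
    permPencil R (Equiv.swap i j * σ) = permPencil R σ
      + vecMulVec (-(X : R[X]) • (σ.permMatrix R[X] *ᵥ (Pi.single i 1 - Pi.single j 1)))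
          (Pi.single i 1 - Pi.single j 1) := by
  rw [permPencil, permPencil, permMatrix_mul, permMatrix_swap, Matrix.mul_sub, mul_one,
    mul_vecMulVec, smul_sub, neg_smul, neg_vecMulVec, smul_vecMulVec]
  abel

/-- The permutation matrix of a transposition differs from 1 by a rank-one matrix built from e_i -
e_j, so the determinant lemma applies and leaves a quadratic form in adj(1 + qP) P. -/
theorem permPencil_swap_mul_det [IsDomain R] (σ : Equiv.Perm ι) (i j : ι) :
    (permPencil R (Equiv.swap i j * σ)).det = (permPencil R σ).det
      - X * (permPencilAdj R σ i i + permPencilAdj R σ j j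
          - permPencilAdj R σ i j - permPencilAdj R σ j i) := by
  rw [permPencil_swap_mul, det_add_vecMulVec_eq _ (permPencil_det_ne_zero R σ), mulVec_smul,
    mulVec_mulVec, ← permPencilAdj, mulVec_sub, dotProduct_smul, dotProduct_sub, sub_dotProduct,
    sub_dotProduct]
  simp
  ring

theorem permPencil_mulVec {σ : Equiv.Perm ι} {v : ι → R[X]} (hv : ∀ i, v (σ i) = v i) :
    permPencil R σ *ᵥ v = (1 + X : R[X]) • v := by
  rw [permPencil, add_mulVec, one_mulVec, smul_mulVec, permMatrix_mulVec,
    show v ∘ σ = v from funext hv, add_smul, one_smul]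

/-- A vector constant on the cycles is an eigenvector of the pencil for 1 + q; applying the adjugate
inverts this up to the determinant. -/
theorem permPencilAdj_mulVec {σ : Equiv.Perm ι} {v : ι → R[X]} (hv : ∀ i, v (σ i) = v i) :
    (1 + X : R[X]) • (permPencilAdj R σ *ᵥ v) = (permPencil R σ).det • v := by
  rw [permPencilAdj, ← mulVec_mulVec, permMatrix_mulVec, show v ∘ σ = v from funext hv,
    ← mulVec_smul, ← permPencil_mulVec R hv, mulVec_mulVec, adjugate_mul, smul_mulVec, one_mulVec]

theorem vecMul_permPencilAdj {σ : Equiv.Perm ι} {v : ι → R[X]} (hv : ∀ i, v (σ i) = v i) :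
    (1 + X : R[X]) • (v ᵥ* permPencilAdj R σ) = (permPencil R σ).det • v := by
  have hv' : v ∘ σ.symm = v := funext fun i => by simpa using (hv (σ.symm i)).symm
  have h1 : v ᵥ* permPencil R σ = (1 + X : R[X]) • v := by
    rw [permPencil, vecMul_add, vecMul_one, vecMul_smul, vecMul_permMatrix, hv', add_smul, one_smul]
  rw [permPencilAdj, ← vecMul_vecMul, ← smul_vecMul, ← smul_vecMul, ← h1, vecMul_vecMul _ (permPencil R σ),
    mul_adjugate, vecMul_smul, vecMul_one, smul_vecMul, vecMul_permMatrix, hv']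

end PermDet

/-! ### Hook polynomials. -/

section HookPoly
open Polynomial Matrix

variable (R : Type*) [CommRing R] {m : ℕ}

/-- The generating polynomial `∑ χ_r(σ) q ^ r` of the hook characters of the symmetric group,
which is `det (1 + q P) / (1 + q)`. -/
noncomputable def hookPoly (σ : Equiv.Perm (Fin (m + 1))) : R[X] :=
  ∑ j, permPencilAdj R σ 0 j

theorem one_add_X_mul_permPencilAdj_row (σ : Equiv.Perm (Fin (m + 1))) (i : Fin (m + 1)) :
    (1 + X) * ∑ j, permPencilAdj R σ i j = (permPencil R σ).det := by
  have h := congrFun (permPencilAdj_mulVec R (σ := σ) (v := fun _ => 1) (fun _ => rfl)) i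
  simpa [mulVec, dotProduct] using h

theorem one_add_X_mul_permPencilAdj_col (σ : Equiv.Perm (Fin (m + 1))) (j : Fin (m + 1)) :
    (1 + X) * ∑ i, permPencilAdj R σ i j = (permPencil R σ).det := by
  have h := congrFun (vecMul_permPencilAdj R (σ := σ) (v := fun _ => 1) (fun _ => rfl)) j
  simpa [vecMul, dotProduct] using h

/-- Taking a row sum of adj(1 + qP) P as the definition performs the division by 1 + q inside the
polynomial ring. -/
theorem one_add_X_mul_hookPoly (σ : Equiv.Perm (Fin (m + 1))) :
    (1 + X) * hookPoly R σ = (permPencil R σ).det :=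
  one_add_X_mul_permPencilAdj_row R σ 0

variable {R} in
theorem one_add_X_mul_left_cancel {f g : R[X]} (h : (1 + X) * f = (1 + X) * g) : f = g := by
  have h1 : (1 + X : R[X]).Monic := by
    rw [add_comm, ← C_1]
    exact monic_X_add_C 1
  exact h1.isRegular.left h

theorem sum_permPencilAdj_row (σ : Equiv.Perm (Fin (m + 1))) (i : Fin (m + 1)) :
    ∑ j, permPencilAdj R σ i j = hookPoly R σ :=
  one_add_X_mul_left_cancel <| by
    rw [one_add_X_mul_permPencilAdj_row, one_add_X_mul_hookPoly]

theorem sum_permPencilAdj_col (σ : Equiv.Perm (Fin (m + 1))) (j : Fin (m + 1)) :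
    ∑ i, permPencilAdj R σ i j = hookPoly R σ :=
  one_add_X_mul_left_cancel <| by
    rw [one_add_X_mul_permPencilAdj_col, one_add_X_mul_hookPoly]

/-- Jacobi's formula: the trace is the derivative of det(1 + qP) = (1 + q) H. -/
theorem sum_permPencilAdj_diag (σ : Equiv.Perm (Fin (m + 1))) :
    ∑ i, permPencilAdj R σ i i = hookPoly R σ + (1 + X) * derivative (hookPoly R σ) := by
  have h := derivative_permPencil_det R σ
  rw [← one_add_X_mul_hookPoly, derivative_mul] at h
  simp only [derivative_add, derivative_one, derivative_X, zero_add, one_mul] at h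
  rw [h, trace]
  rfl

theorem one_add_X_mul_hookPoly_swap_mul [IsDomain R] (σ : Equiv.Perm (Fin (m + 1)))
    (i j : Fin (m + 1)) :
    (1 + X) * hookPoly R (Equiv.swap i j * σ) = (1 + X) * hookPoly R σ
      - X * (permPencilAdj R σ i i + permPencilAdj R σ j j
          - permPencilAdj R σ i j - permPencilAdj R σ j i) := by
  rw [one_add_X_mul_hookPoly, one_add_X_mul_hookPoly, permPencil_swap_mul_det]

theorem sum_sum_hookPoly_swap_mul [IsDomain R] (σ : Equiv.Perm (Fin (m + 1))) :
    ∑ i, ∑ j, hookPoly R (Equiv.swap i j * σ)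
      = ((m + 1 : ℕ) : R[X]) ^ 2 * hookPoly R σ
        - 2 * ((m + 1 : ℕ) : R[X]) * (X * derivative (hookPoly R σ)) := by
  apply one_add_X_mul_left_cancel
  simp_rw [mul_sum, one_add_X_mul_hookPoly_swap_mul, Finset.sum_sub_distrib, ← mul_sum,
    Finset.sum_sub_distrib, Finset.sum_add_distrib]
  rw [Finset.sum_comm (f := fun i j => permPencilAdj R σ j i)]
  simp only [Finset.sum_const, Finset.card_univ, Fintype.card_fin, nsmul_eq_mul, ← mul_sum,
    sum_permPencilAdj_row, sum_permPencilAdj_diag]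
  ring

theorem decomposeFin_symm_eq_swap_mul {n : ℕ} (p : Fin (n + 1)) (e : Equiv.Perm (Fin n)) :
    Equiv.Perm.decomposeFin.symm (p, e)
      = Equiv.swap 0 p * Equiv.Perm.decomposeFin.symm (0, e) := by
  ext x
  refine Fin.cases ?_ (fun i => ?_) x <;> simp

theorem permPencil_det_of_fix_zero {n : ℕ} (σ : Equiv.Perm (Fin (n + 1))) (e : Equiv.Perm (Fin n))
    (h0 : σ 0 = 0) (hs : ∀ i, σ (Fin.succ i) = (e i).succ) :
    (permPencil R σ).det = (1 + X) * (permPencil R e).det := by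
  have hz : ∀ j, j ≠ 0 → permPencil R σ 0 j = 0 := by
    intro j hj
    rw [permPencil_apply, h0, if_neg hj.symm, mul_zero, add_zero]
  have hsub : (permPencil R σ).submatrix Fin.succ (Fin.succAbove 0) = permPencil R e := by
    ext1 i j
    rw [submatrix_apply, Fin.succAbove_zero, permPencil_apply, permPencil_apply, hs]
    simp only [Fin.succ_inj]
  rw [det_succ_row_zero, Finset.sum_eq_single 0 (fun j _ hj => by rw [hz j hj, mul_zero, zero_mul])
    (by simp), hsub, permPencil_apply, h0]
  simp

theorem permPencil_det_decomposeFin_zero {n : ℕ} (e : Equiv.Perm (Fin n)) :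
    (permPencil R (Equiv.Perm.decomposeFin.symm (0, e))).det
      = (1 + X) * (permPencil R e).det :=
  permPencil_det_of_fix_zero R _ e (Equiv.Perm.decomposeFin_symm_apply_zero 0 e) fun i => by
    rw [Equiv.Perm.decomposeFin_symm_apply_succ, Equiv.swap_self, Equiv.refl_apply]

theorem hookPoly_decomposeFin_zero (e : Equiv.Perm (Fin (m + 1))) :
    hookPoly R (Equiv.Perm.decomposeFin.symm (0, e)) = (1 + X) * hookPoly R e :=
  one_add_X_mul_left_cancel <| by
    rw [one_add_X_mul_hookPoly, permPencil_det_decomposeFin_zero, one_add_X_mul_hookPoly]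

theorem permPencilAdj_decomposeFin_zero (e : Equiv.Perm (Fin (m + 1))) :
    permPencilAdj R (Equiv.Perm.decomposeFin.symm (0, e)) 0 0
      = hookPoly R (Equiv.Perm.decomposeFin.symm (0, e)) := by
  apply one_add_X_mul_left_cancel
  rw [one_add_X_mul_hookPoly]
  have h := congrFun (permPencilAdj_mulVec R (σ := Equiv.Perm.decomposeFin.symm (0, e))
    (v := Pi.single 0 1) (Fin.cases (by simp) (fun i => by simp))) 0
  simpa using h

/-- Inserting the point 0 into a cycle of `e` amounts to multiplying the extension of `e` fixing 0
by a transposition (0 p). The sum over all p needs only the row and column of 0, the trace and the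
corner entry; the term p = 0 is then removed. -/
theorem sum_hookPoly_decomposeFin_succ [IsDomain R] (e : Equiv.Perm (Fin (m + 1))) :
    ∑ p : Fin (m + 1), hookPoly R (Equiv.Perm.decomposeFin.symm (p.succ, e))
      = (((m + 1 : ℕ) : R[X]) - X) * hookPoly R e
        - X * (1 + X) * derivative (hookPoly R e) := by
  set σ := Equiv.Perm.decomposeFin.symm ((0 : Fin (m + 2)), e) with hσ
  have hall : ∑ p : Fin (m + 2), (1 + X) * hookPoly R (Equiv.swap 0 p * σ)
      = ((m + 2 : ℕ) : R[X]) * ((1 + X) * hookPoly R σ)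
        - X * (((m + 2 : ℕ) : R[X]) * hookPoly R σ
          + (hookPoly R σ + (1 + X) * derivative (hookPoly R σ)) - 2 * hookPoly R σ) := by
    simp_rw [one_add_X_mul_hookPoly_swap_mul, Finset.sum_sub_distrib, ← mul_sum,
      Finset.sum_sub_distrib, Finset.sum_add_distrib, sum_permPencilAdj_row,
      sum_permPencilAdj_col, sum_permPencilAdj_diag, hσ, permPencilAdj_decomposeFin_zero]
    simp only [Finset.sum_const, Finset.card_univ, Fintype.card_fin, nsmul_eq_mul]
    ring
  rw [Fin.sum_univ_succ, Equiv.swap_self, show (Equiv.refl (Fin (m + 2))) * σ = σ from one_mul σ,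
    hσ, hookPoly_decomposeFin_zero, derivative_mul] at hall
  simp_rw [← decomposeFin_symm_eq_swap_mul] at hall
  simp only [derivative_add, derivative_one, derivative_X, zero_add, one_mul] at hall
  apply one_add_X_mul_left_cancel
  rw [mul_sum]
  push_cast at hall ⊢
  linear_combination hall

theorem hookPoly_fin_one (σ : Equiv.Perm (Fin 1)) : hookPoly R σ = 1 := by
  rw [Subsingleton.elim σ 1]
  simp [hookPoly, permPencilAdj]

/-- Take the trace of adj(1 + qP)(1 + qP) = det · 1 and put q = -1: the determinant and the
derivative term both carry a factor 1 + q. -/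
theorem hookPoly_eval_neg_one (σ : Equiv.Perm (Fin (m + 1))) :
    (hookPoly R σ).eval (-1) = (1 - σ.permMatrix R).adjugate.trace := by
  have h1 : (permPencil R σ).adjugate.trace + X * (permPencilAdj R σ).trace
      = ((m + 1 : ℕ) : R[X]) * (permPencil R σ).det := by
    have h := congrArg Matrix.trace (adjugate_mul (permPencil R σ))
    nth_rw 2 [permPencil] at h
    rw [mul_add, mul_one, Matrix.mul_smul, ← permPencilAdj, trace_add, trace_smul, trace_smul,
      trace_one, Fintype.card_fin, smul_eq_mul, smul_eq_mul] at h
    rw [h, mul_comm]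
  have h2 : (permPencilAdj R σ).trace
      = hookPoly R σ + (1 + X) * derivative (hookPoly R σ) := sum_permPencilAdj_diag R σ
  have h3 : (permPencil R σ).adjugate.trace.eval (-1)
      = (1 - σ.permMatrix R).adjugate.trace := by
    have : (evalRingHom (-1 : R)).mapMatrix (permPencil R σ) = 1 - σ.permMatrix R := by
      ext i j
      rw [RingHom.mapMatrix_apply, Matrix.map_apply, permPencil, Matrix.add_apply,
        Matrix.smul_apply, permMatrix_entry, Matrix.sub_apply, permMatrix_entry, Matrix.one_apply,
        Matrix.one_apply]
      split_ifs <;> simp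
    rw [← this, ← RingHom.map_adjugate]
    exact AddMonoidHom.map_trace (evalRingHom (-1 : R)) _
  rw [h2, ← one_add_X_mul_hookPoly] at h1
  have h4 := congrArg (Polynomial.eval (-1 : R)) h1
  simp only [eval_add, h3, eval_mul, eval_X, eval_one] at h4
  linear_combination -h4

theorem hookPoly_eval_neg_one_eq_zero [IsDomain R] {σ : Equiv.Perm (Fin (m + 1))}
    (S : Set (Fin (m + 1))) (hS : ∀ i, σ i ∈ S ↔ i ∈ S) (h0 : S.Nonempty) (h1 : Sᶜ.Nonempty) :
    (hookPoly R σ).eval (-1) = 0 := by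
  classical
  rw [hookPoly_eval_neg_one, trace]
  refine Finset.sum_eq_zero fun i _ => ?_
  obtain ⟨T, hT, ⟨t, ht⟩, hi⟩ : ∃ T : Set (Fin (m + 1)), (∀ i, σ i ∈ T ↔ i ∈ T) ∧ T.Nonempty
      ∧ i ∉ T := by
    by_cases hi : i ∈ S
    · exact ⟨Sᶜ, fun i => not_congr (hS i), h1, fun h => h hi⟩
    · exact ⟨S, hS, h0, hi⟩
  -- The i-th diagonal cofactor vanishes because the indicator of an invariant set avoiding i
  -- remains in the kernel after row i is replaced by e_i.
  rw [diag_apply, adjugate_apply, ← exists_mulVec_eq_zero_iff]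
  refine ⟨fun j => if j ∈ T then 1 else 0, fun h => ?_, ?_⟩
  · simpa [ht] using congrFun h t
  · have hv : (1 - σ.permMatrix R) *ᵥ (fun j => if j ∈ T then (1 : R) else 0) = 0 := by
      rw [sub_mulVec, one_mulVec, permMatrix_mulVec, sub_eq_zero]
      funext j
      simp [hT]
    funext j
    by_cases hj : j = i
    · subst hj
      simp [mulVec, hi]
    · have := congrFun hv j
      simpa [mulVec, updateRow_ne hj] using this

end HookPoly

/-! ### Full cycles and cycle counts. -/

theorem isConj_finRotate_of_transitive {m : ℕ} (σ : Equiv.Perm (Fin (m + 1)))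
    (h : ∀ S : Set (Fin (m + 1)), (∀ i, σ i ∈ S ↔ i ∈ S) → S.Nonempty → ¬ Sᶜ.Nonempty) :
    IsConj σ (finRotate (m + 1)) := by
  rcases m with _ | m
  · rw [show σ = finRotate 1 from Equiv.ext fun _ => Subsingleton.elim (α := Fin 1) _ _]
  have hsame : ∀ x y, σ.SameCycle x y := by
    intro x y
    by_contra hxy
    refine h {z | σ.SameCycle x z} (fun i => ?_) ⟨x, Equiv.Perm.SameCycle.refl _ _⟩ ⟨y, hxy⟩
    exact Equiv.Perm.sameCycle_apply_right
  have hmove : ∀ x, σ x ≠ x := by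
    intro x hx
    obtain ⟨y, hy⟩ := exists_ne x
    obtain ⟨i, hi⟩ := hsame x y
    rw [Equiv.Perm.zpow_apply_eq_self_of_apply_eq_self hx] at hi
    exact hy hi.symm
  have hc : σ.IsCycle := ⟨0, hmove 0, fun y _ => hsame 0 y⟩
  have hs : σ.support = univ := by
    ext x
    simp [hmove x]
  rw [Equiv.Perm.isConj_iff_cycleType_eq, hc.cycleType, cycleType_finRotate, hs]
  simp

theorem cycleCount_eq_card_cycleType_add {n : ℕ} (σ : Equiv.Perm (Fin n)) :
    cycleCount σ = Multiset.card σ.cycleType + (n - #σ.support) := by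
  rw [cycleCount, Equiv.Perm.parts_partition, Multiset.card_add, Multiset.card_replicate,
    Fintype.card_fin]

theorem cycleCount_eq_of_isConj {n : ℕ} {σ τ : Equiv.Perm (Fin n)} (h : IsConj σ τ) :
    cycleCount σ = cycleCount τ := by
  rw [cycleCount, cycleCount, Equiv.Perm.partition_eq_of_isConj.mp h]

theorem sign_eq_neg_one_pow_cycleCount {n : ℕ} (σ : Equiv.Perm (Fin n)) :
    Equiv.Perm.sign σ = (-1) ^ (n + cycleCount σ) := by
  have h : #σ.support ≤ n := by simpa using σ.support.card_le_univ
  rw [Equiv.Perm.sign_of_cycleType, Equiv.Perm.sum_cycleType, cycleCount_eq_card_cycleType_add,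
    show n + (Multiset.card σ.cycleType + (n - #σ.support))
      = (#σ.support + Multiset.card σ.cycleType) + 2 * (n - #σ.support) by omega,
    pow_add _ _ (2 * _), pow_mul]
  simp

theorem card_quotient_sameCycle {n : ℕ} (σ : Equiv.Perm (Fin n)) :
    Nat.card (Quotient (Equiv.Perm.SameCycle.setoid σ)) = cycleCount σ := by
  classical
  have hex : ∀ c : σ.cycleFactorsFinset, ∃ x, x ∈ (c : Equiv.Perm (Fin n)).support := fun c =>
    (Equiv.Perm.mem_cycleFactorsFinset_iff.mp c.2).1.nonempty_support
  choose a ha using hex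
  have hcyc : ∀ c : σ.cycleFactorsFinset, σ.cycleOf (a c) = c := fun c =>
    (Equiv.Perm.cycle_is_cycleOf (ha c) c.2).symm
  have hmov : ∀ c : σ.cycleFactorsFinset, σ (a c) ≠ a c := fun c =>
    Equiv.Perm.mem_support.mp
      (Equiv.Perm.mem_cycleFactorsFinset_support_le c.2 (ha c))
  let g : σ.cycleFactorsFinset ⊕ {x // x ∉ σ.support} →
      Quotient (Equiv.Perm.SameCycle.setoid σ) :=
    Sum.elim (fun c => Quotient.mk _ (a c)) (fun x => Quotient.mk _ x.1)
  have hg : Function.Bijective g := by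
    constructor
    · rintro (c | x) (d | y) h
      · have h' : σ.SameCycle (a c) (a d) := Quotient.exact h
        have := h'.cycleOf_eq
        rw [hcyc, hcyc] at this
        rw [Subtype.ext this]
      · have h' : σ.SameCycle (a c) y := Quotient.exact h
        exact absurd (h'.apply_eq_self_iff.mpr (by simpa using y.2)) (hmov c)
      · have h' : σ.SameCycle x (a d) := Quotient.exact h
        exact absurd (h'.apply_eq_self_iff.mp (by simpa using x.2)) (hmov d)
      · have h' : σ.SameCycle x y := Quotient.exact h
        obtain ⟨i, hi⟩ := h'
        rw [Equiv.Perm.zpow_apply_eq_self_of_apply_eq_self (by simpa using x.2)] at hi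
        rw [Subtype.ext hi]
    · intro q
      induction q using Quotient.inductionOn with
      | h x =>
        by_cases hx : x ∈ σ.support
        · have hm : σ.cycleOf x ∈ σ.cycleFactorsFinset :=
            Equiv.Perm.cycleOf_mem_cycleFactorsFinset_iff.mpr hx
          refine ⟨Sum.inl ⟨_, hm⟩, Quotient.sound ?_⟩
          have := ha ⟨_, hm⟩
          rw [Equiv.Perm.mem_support_cycleOf_iff' (Equiv.Perm.mem_support.mp hx)] at this
          exact this.symm
        · exact ⟨Sum.inr ⟨x, hx⟩, rfl⟩
  rw [← Nat.card_congr (Equiv.ofBijective g hg), Nat.card_sum, cycleCount_eq_card_cycleType_add,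
    Equiv.Perm.cycleType_def]
  have hc : Nat.card {x // x ∉ σ.support} = n - #σ.support := by
    rw [Nat.card_eq_fintype_card, Fintype.card_subtype_compl, Fintype.card_fin,
      Fintype.card_coe]
  rw [hc]
  simp

/-- The two-colourings of the ground set which are constant on the cycles of `σ`. -/
def invariantColorings {n : ℕ} (σ : Equiv.Perm (Fin n)) : Finset (Fin n → Bool) :=
  univ.filter fun f => ∀ x, f (σ x) = f x

theorem mem_invariantColorings {n : ℕ} {σ : Equiv.Perm (Fin n)} {f : Fin n → Bool} :
    f ∈ invariantColorings σ ↔ ∀ x, f (σ x) = f x := by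
  simp [invariantColorings]

/-- Turns comparisons of cycle counts into bijections and injections between sets of colourings. -/
theorem card_invariantColorings {n : ℕ} (σ : Equiv.Perm (Fin n)) :
    #(invariantColorings σ) = 2 ^ cycleCount σ := by
  have hiff : ∀ f : Fin n → Bool, f ∈ invariantColorings σ ↔
      Equiv.Perm.SameCycle.setoid σ ≤ Setoid.ker f := by
    intro f
    rw [mem_invariantColorings]
    refine ⟨fun h x y hxy => ?_, fun h x => ?_⟩
    · obtain ⟨i, _, rfl⟩ := Equiv.Perm.SameCycle.exists_pow_eq' hxy
      clear hxy
      have hi : ∀ i : ℕ, f ((σ ^ i) x) = f x := by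
        intro i
        induction i with
        | zero => rfl
        | succ i ih => rw [pow_succ', Equiv.Perm.mul_apply, h, ih]
      exact (hi i).symm
    · exact h (x := σ x) (y := x)
        (Equiv.Perm.sameCycle_apply_left.mpr (Equiv.Perm.SameCycle.refl σ x))
  have e : {f // f ∈ invariantColorings σ} ≃
      (Quotient (Equiv.Perm.SameCycle.setoid σ) → Bool) :=
    (Equiv.subtypeEquivRight hiff).trans (Setoid.liftEquiv _)
  have h := Nat.card_congr e
  rw [Nat.card_fun, card_quotient_sameCycle] at h
  simpa using h

theorem cycleCount_decomposeFin_zero {n : ℕ} (e : Equiv.Perm (Fin n)) :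
    cycleCount (Equiv.Perm.decomposeFin.symm (0, e)) = cycleCount e + 1 := by
  apply Nat.pow_right_injective (le_refl 2)
  change 2 ^ _ = 2 ^ _
  rw [← card_invariantColorings, pow_succ, ← card_invariantColorings, mul_comm,
    show 2 = #(univ : Finset Bool) from rfl, ← Finset.card_product]
  refine Finset.card_nbij' (fun f => (f 0, fun i => f i.succ)) (fun g => Fin.cons g.1 g.2)
    ?_ ?_ ?_ ?_
  · intro f hf
    have hf := mem_invariantColorings.mp hf
    simp only [coe_product, Set.mem_prod, coe_univ, Set.mem_univ, true_and, mem_coe]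
    exact mem_invariantColorings.mpr fun i => by simpa using hf i.succ
  · rintro ⟨b, g⟩ hg
    simp only [coe_product, Set.mem_prod, coe_univ, Set.mem_univ, true_and, mem_coe] at hg
    have hg := mem_invariantColorings.mp hg
    refine mem_invariantColorings.mpr (Fin.cases ?_ fun i => ?_)
    · simp
    · simpa using hg i
  · intro f _
    exact Fin.cons_self_tail f
  · rintro ⟨b, g⟩ _
    simp

/-- The point 0 is inserted just before `p.succ` in its cycle, so its colour is forced to be that of
`p`. -/
theorem cycleCount_decomposeFin_succ {n : ℕ} (p : Fin n) (e : Equiv.Perm (Fin n)) :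
    cycleCount (Equiv.Perm.decomposeFin.symm (p.succ, e)) = cycleCount e := by
  apply Nat.pow_right_injective (le_refl 2)
  change 2 ^ _ = 2 ^ _
  rw [← card_invariantColorings, ← card_invariantColorings]
  have hswap : ∀ f : Fin (n + 1) → Bool, f 0 = f p.succ →
      ∀ y, f (Equiv.swap 0 p.succ y) = f y := by
    intro f hf y
    rw [Equiv.swap_apply_def]
    split_ifs with h1 h2
    · rw [h1, hf]
    · rw [h2, hf]
    · rfl
  refine Finset.card_nbij' (fun f i => f i.succ) (fun g => Fin.cons (g p) g) ?_ ?_ ?_ ?_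
  · intro f hf
    have hf := mem_invariantColorings.mp hf
    have h0 : f 0 = f p.succ := by simpa using (hf 0).symm
    refine mem_invariantColorings.mpr fun i => ?_
    have := hf i.succ
    rwa [Equiv.Perm.decomposeFin_symm_apply_succ, hswap f h0] at this
  · intro g hg
    have hg := mem_invariantColorings.mp hg
    refine mem_invariantColorings.mpr (Fin.cases ?_ fun i => ?_)
    · simp
    · beta_reduce
      rw [Equiv.Perm.decomposeFin_symm_apply_succ, hswap (Fin.cons (g p) g) (by simp)]
      simpa using hg i
  · intro f hf
    have hf := mem_invariantColorings.mp hf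
    have h0 : f 0 = f p.succ := by simpa using (hf 0).symm
    funext i
    refine Fin.cases ?_ (fun i => ?_) i
    · simp [h0]
    · simp
  · intro g _
    simp

theorem cycleCount_swap_mul_le {n : ℕ} (i j : Fin n) (σ : Equiv.Perm (Fin n)) :
    cycleCount (Equiv.swap i j * σ) ≤ cycleCount σ + 1 := by
  rw [← Nat.pow_le_pow_iff_right (Nat.one_lt_two), pow_succ, ← card_invariantColorings,
    ← card_invariantColorings]
  set A := invariantColorings (Equiv.swap i j * σ) with hA
  have h1 : A.filter (fun f => f i = f j) ⊆ invariantColorings σ := by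
    intro f hf
    rw [mem_filter, hA, mem_invariantColorings] at hf
    refine mem_invariantColorings.mpr fun x => ?_
    rw [← hf.1 x, Equiv.Perm.mul_apply, Equiv.swap_apply_def]
    split_ifs with h h'
    · rw [h, hf.2]
    · rw [h', hf.2]
    · rfl
  have h2 : #(A.filter fun f => ¬ f i = f j) ≤ #(A.filter fun f => f i = f j) := by
    rcases (A.filter fun f => ¬ f i = f j).eq_empty_or_nonempty with h | ⟨g, hg⟩
    · simp [h]
    -- Adding a fixed colouring `g` that separates i and j sends the separating colourings
    -- injectively to the non-separating ones, which are therefore at least half of `A`.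
    · refine Finset.card_le_card_of_injOn (fun f x => xor (f x) (g x)) ?_ ?_
      · intro f hf
        simp only [coe_filter, Set.mem_ofPred_eq, mem_filter, hA, mem_invariantColorings]
          at hf hg ⊢
        refine ⟨fun x => by rw [hf.1, hg.1], ?_⟩
        have h3 := hf.2
        have h4 := hg.2
        revert h3 h4
        generalize f i = a
        generalize f j = b
        generalize g i = c
        generalize g j = d
        revert a b c d
        decide
      · intro f _ f' _ h
        funext x
        simpa using congrFun h x
  calc #A = #(A.filter fun f => f i = f j) + #(A.filter fun f => ¬ f i = f j) :=
        (Finset.card_filter_add_card_filter_not _).symm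
    _ ≤ #(invariantColorings σ) * 2 := by
        have := Finset.card_le_card h1
        omega

/-- The count moves by at most one in either direction, since a transposition is an involution, and
the sign forbids equality. -/
theorem cycleCount_swap_mul_or {n : ℕ} {τ : Equiv.Perm (Fin n)} (hτ : τ.IsSwap)
    (σ : Equiv.Perm (Fin n)) :
    cycleCount (τ * σ) = cycleCount σ + 1 ∨ cycleCount (τ * σ) + 1 = cycleCount σ := by
  have hs := hτ.sign_eq
  obtain ⟨i, j, hij, rfl⟩ := hτ
  have h1 := cycleCount_swap_mul_le i j σ
  have h2 := cycleCount_swap_mul_le i j (Equiv.swap i j * σ)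
  rw [← mul_assoc, Equiv.swap_mul_self, one_mul] at h2
  have h3 : cycleCount (Equiv.swap i j * σ) ≠ cycleCount σ := by
    intro h
    have h4 := sign_eq_neg_one_pow_cycleCount (Equiv.swap i j * σ)
    rw [h, ← sign_eq_neg_one_pow_cycleCount, map_mul, hs] at h4
    rcases Int.units_eq_one_or (Equiv.Perm.sign σ) with h5 | h5 <;> rw [h5] at h4 <;>
      exact absurd h4 (by decide)
  omega

/-! ### The adjacency operator and walk sums. -/

section TranspositionSum

variable {A : Type*} [CommRing A] {n : ℕ}

open Classical in
/-- The adjacency operator of the Cayley graph generated by the transpositions. -/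
noncomputable def transpositionSum (f : Equiv.Perm (Fin n) → A) (σ : Equiv.Perm (Fin n)) : A :=
  ∑ ρ with (transpositionGraph n).Adj σ ρ, f ρ

theorem transpositionGraph_adj_iff {σ ρ : Equiv.Perm (Fin n)} :
    (transpositionGraph n).Adj σ ρ ↔ ∃ i j, i ≠ j ∧ ρ = Equiv.swap i j * σ := by
  rw [SimpleGraph.adj_comm]
  simp only [transpositionGraph, Equiv.Perm.IsSwap, mul_inv_eq_iff_eq_mul]

theorem swap_eq_swap_cases {α : Type*} [DecidableEq α] {i j a b : α} (hij : i ≠ j)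
    (h : Equiv.swap i j = Equiv.swap a b) : (i = a ∧ j = b) ∨ (i = b ∧ j = a) := by
  have h1 := congrFun (congrArg DFunLike.coe h) i
  rw [Equiv.swap_apply_left, Equiv.swap_apply_def] at h1
  split_ifs at h1 with h2 h3
  · exact Or.inl ⟨h2, h1⟩
  · exact Or.inr ⟨h3, h1⟩
  · exact absurd h1.symm hij

/-- The n diagonal pairs give the identity, and each transposition arises from two ordered pairs. -/
theorem sum_sum_swap_mul (f : Equiv.Perm (Fin n) → A) (σ : Equiv.Perm (Fin n)) :
    ∑ i, ∑ j, f (Equiv.swap i j * σ) = (n : A) * f σ + 2 * transpositionSum f σ := by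
  classical
  rw [← Finset.sum_product', Finset.univ_product_univ,
    ← Finset.sum_filter_add_sum_filter_not univ (fun p : Fin n × Fin n => p.1 = p.2)]
  congr 1
  · rw [Finset.sum_congr rfl (g := fun _ => f σ), Finset.sum_const]
    · rw [nsmul_eq_mul]
      have hd : (univ.filter fun p : Fin n × Fin n => p.1 = p.2) = (univ : Finset (Fin n)).diag := by
        ext p
        simp [Finset.mem_diag]
      rw [hd, Finset.diag_card, Finset.card_univ, Fintype.card_fin]
    · intro p hp
      rw [(Finset.mem_filter.mp hp).2, Equiv.swap_self]
      rfl
  · rw [transpositionSum, mul_sum,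
      ← Finset.sum_fiberwise_of_maps_to
        (t := univ.filter fun ρ => (transpositionGraph n).Adj σ ρ)
        (g := fun p : Fin n × Fin n => Equiv.swap p.1 p.2 * σ)]
    · refine Finset.sum_congr rfl fun ρ hρ => ?_
      obtain ⟨a, b, hab, rfl⟩ := transpositionGraph_adj_iff.mp (Finset.mem_filter.mp hρ).2
      rw [Finset.sum_congr rfl (g := fun _ => f (Equiv.swap a b * σ)), Finset.sum_const]
      · rw [nsmul_eq_mul]
        congr 1
        have : ((univ.filter fun p : Fin n × Fin n => ¬ p.1 = p.2).filter
            fun p => Equiv.swap p.1 p.2 * σ = Equiv.swap a b * σ) = {(a, b), (b, a)} := by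
          ext ⟨i, j⟩
          simp only [mem_filter, mem_univ, true_and, mul_left_inj, mem_insert, mem_singleton,
            Prod.mk.injEq]
          refine ⟨fun h => swap_eq_swap_cases h.1 h.2, ?_⟩
          rintro (⟨rfl, rfl⟩ | ⟨rfl, rfl⟩)
          · exact ⟨hab, rfl⟩
          · exact ⟨hab.symm, Equiv.swap_comm _ _⟩
        rw [this, Finset.card_pair (fun h => hab (congrArg Prod.fst h))]
        norm_num
      · intro p hp
        rw [(Finset.mem_filter.mp hp).2]
    · intro p hp
      exact Finset.mem_filter.mpr ⟨Finset.mem_univ _, transpositionGraph_adj_iff.mpr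
        ⟨p.1, p.2, (Finset.mem_filter.mp hp).2, rfl⟩⟩

theorem sum_mul_transpositionSum (f g : Equiv.Perm (Fin n) → A) :
    ∑ σ, g σ * transpositionSum f σ = ∑ σ, transpositionSum g σ * f σ := by
  classical
  simp_rw [transpositionSum, mul_sum, sum_mul, Finset.sum_filter]
  rw [Finset.sum_comm]
  simp_rw [SimpleGraph.adj_comm]

theorem map_transpositionSum {B : Type*} [CommRing B] (φ : A →+* B)
    (f : Equiv.Perm (Fin n) → A) (σ : Equiv.Perm (Fin n)) :
    φ (transpositionSum f σ) = transpositionSum (fun ρ => φ (f ρ)) σ := by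
  simp [transpositionSum]

theorem transpositionGraph_adj_conj (g σ ρ : Equiv.Perm (Fin n)) :
    (transpositionGraph n).Adj (g * σ * g⁻¹) (g * ρ * g⁻¹) ↔ (transpositionGraph n).Adj σ ρ := by
  change Equiv.Perm.IsSwap _ ↔ Equiv.Perm.IsSwap _
  rw [Equiv.Perm.isSwap_iff_cycleType, Equiv.Perm.isSwap_iff_cycleType,
    show g * σ * g⁻¹ * (g * ρ * g⁻¹)⁻¹ = g * (σ * ρ⁻¹) * g⁻¹ by group,
    Equiv.Perm.cycleType_conj]

theorem transpositionSum_conj {f : Equiv.Perm (Fin n) → A}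
    (hf : ∀ g σ, f (g * σ * g⁻¹) = f σ) (g σ : Equiv.Perm (Fin n)) :
    transpositionSum f (g * σ * g⁻¹) = transpositionSum f σ := by
  classical
  simp_rw [transpositionSum, Finset.sum_filter]
  rw [← Equiv.sum_comp (MulAut.conj g).toEquiv]
  refine Finset.sum_congr rfl fun ρ _ => ?_
  simp only [MulEquiv.toEquiv_eq_coe, MulEquiv.coe_toEquiv, MulAut.conj_apply, hf,
    transpositionGraph_adj_conj]

/-- The sum of `x ^ ℓ(ρ)` over the endpoints `ρ` of the walks of length `k` which start at `σ`. -/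
noncomputable def endpointSum (x : A) : ℕ → Equiv.Perm (Fin n) → A
  | 0 => fun σ => x ^ cycleCount σ
  | k + 1 => transpositionSum (endpointSum x k)

theorem endpointSum_conj (x : A) (k : ℕ) (g σ : Equiv.Perm (Fin n)) :
    endpointSum x k (g * σ * g⁻¹) = endpointSum x k σ := by
  induction k generalizing g σ with
  | zero =>
    change x ^ cycleCount _ = x ^ cycleCount _
    rw [cycleCount_eq_of_isConj (isConj_iff.mpr ⟨g⁻¹, _⟩)]
    group
  | succ k ih => exact transpositionSum_conj ih g σ

end TranspositionSum

/-! ### Pairing hook polynomials with walk sums. -/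

section HookSum
open Polynomial

variable {R : Type*} [CommRing R] {m : ℕ}

/-- The operator on polynomials in `q` which corresponds to `2 • transpositionSum`. -/
noncomputable def contentOp (m : ℕ) (g : R[X]) : R[X] :=
  ((m + 1 : ℕ) : R[X]) * (m : R[X]) * g - 2 * ((m + 1 : ℕ) : R[X]) * (X * derivative g)

theorem two_mul_transpositionSum_hookPoly [IsDomain R] (σ : Equiv.Perm (Fin (m + 1))) :
    2 * transpositionSum (hookPoly R) σ = contentOp m (hookPoly R σ) := by
  have h1 := sum_sum_swap_mul (hookPoly R) σ
  rw [sum_sum_hookPoly_swap_mul] at h1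
  rw [contentOp]
  push_cast at h1 ⊢
  linear_combination -h1

theorem contentOp_sum_mul_C {ι : Type*} (s : Finset ι) (g : ι → R[X]) (a : ι → R) :
    contentOp m (∑ i ∈ s, g i * C (a i)) = ∑ i ∈ s, contentOp m (g i) * C (a i) := by
  simp only [contentOp, derivative_sum, mul_sum, ← Finset.sum_sub_distrib]
  refine Finset.sum_congr rfl fun i _ => ?_
  simp only [derivative_mul, derivative_C]
  ring

theorem contentOp_C_mul (a : R) (g : R[X]) : contentOp m (C a * g) = C a * contentOp m g := by
  simp only [contentOp, derivative_mul, derivative_C]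
  ring

/-- The operator is diagonal on powers of q; with r = j and s = m - j the eigenvalue is n(s - r),
twice the content sum of the hook with leg r. -/
theorem coeff_contentOp (g : R[X]) (j : ℕ) :
    (contentOp m g).coeff j = ((m + 1 : ℕ) : R) * ((m : R) - 2 * (j : R)) * g.coeff j := by
  have h1 : contentOp m g = C (((m + 1 : ℕ) : R) * (m : R)) * g
      - C (2 * ((m + 1 : ℕ) : R)) * (X * derivative g) := by
    simp [contentOp, show (C 2 : R[X]) = 2 from map_ofNat C 2]
  rw [h1, coeff_sub, coeff_C_mul, coeff_C_mul]
  rcases j with _ | j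
  · simp
  · rw [coeff_X_mul, coeff_derivative]
    push_cast
    ring

theorem coeff_contentOp_iterate (g : R[X]) (k j : ℕ) :
    ((contentOp m)^[k] g).coeff j
      = (((m + 1 : ℕ) : R) * ((m : R) - 2 * (j : R))) ^ k * g.coeff j := by
  induction k with
  | zero => simp
  | succ k ih =>
    rw [Function.iterate_succ_apply', coeff_contentOp, ih]
    ring

theorem sum_hookPoly_mul_endpointSum [IsDomain R] (x : R) (k : ℕ) :
    ∑ σ : Equiv.Perm (Fin (m + 1)), hookPoly R σ * C (2 ^ k * endpointSum x k σ)
      = (contentOp m)^[k] (∑ σ : Equiv.Perm (Fin (m + 1)), hookPoly R σ * C (x ^ cycleCount σ)) := by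
  induction k with
  | zero => simp [endpointSum]
  | succ k ih =>
    rw [Function.iterate_succ_apply', ← ih, contentOp_sum_mul_C]
    simp_rw [← two_mul_transpositionSum_hookPoly]
    have h := sum_mul_transpositionSum (fun σ => C (endpointSum x k σ))
      (hookPoly R (m := m))
    calc _ = C (2 ^ (k + 1)) * ∑ σ : Equiv.Perm (Fin (m + 1)),
          hookPoly R σ * transpositionSum (fun σ => C (endpointSum x k σ)) σ := by
          rw [mul_sum]
          refine Finset.sum_congr rfl fun σ _ => ?_
          rw [← map_transpositionSum, C_mul, endpointSum]
          ring
      _ = _ := by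
          rw [h, mul_sum]
          refine Finset.sum_congr rfl fun σ _ => ?_
          simp only [pow_succ, C_mul, C_pow, C_ofNat]
          ring

/-- The inserted point is either a new fixed point, contributing x(1 + q), or joins an existing
cycle without changing the count. -/
theorem sum_hookPoly_mul_pow_cycleCount_succ [IsDomain R] (x : R) (m : ℕ) :
    ∑ σ : Equiv.Perm (Fin (m + 2)), hookPoly R σ * C (x ^ cycleCount σ)
      = (C x * (1 + X) + ((m + 1 : ℕ) : R[X]) - X)
          * ∑ σ : Equiv.Perm (Fin (m + 1)), hookPoly R σ * C (x ^ cycleCount σ)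
        - X * (1 + X)
          * derivative (∑ σ : Equiv.Perm (Fin (m + 1)), hookPoly R σ * C (x ^ cycleCount σ)) := by
  rw [← Equiv.sum_comp Equiv.Perm.decomposeFin.symm, Fintype.sum_prod_type_right, derivative_sum,
    mul_sum, mul_sum, ← Finset.sum_sub_distrib]
  refine Finset.sum_congr rfl fun e _ => ?_
  rw [Fin.sum_univ_succ, hookPoly_decomposeFin_zero, cycleCount_decomposeFin_zero]
  simp_rw [cycleCount_decomposeFin_succ]
  rw [← sum_mul, sum_hookPoly_decomposeFin_succ, derivative_mul, derivative_C, pow_succ, C_mul]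
  ring

theorem sum_hookPoly_mul_pow_cycleCount_fin_one (x : R) :
    ∑ σ : Equiv.Perm (Fin 1), hookPoly R σ * C (x ^ cycleCount σ) = C x := by
  have h := cycleCount_decomposeFin_zero (n := 0) 1
  rw [Subsingleton.elim (Equiv.Perm.decomposeFin.symm ((0 : Fin 1), (1 : Equiv.Perm (Fin 0))))
    (1 : Equiv.Perm (Fin 1))] at h
  have h0 : cycleCount (1 : Equiv.Perm (Fin 0)) = 0 := Nat.le_zero.mp (cycleCount_le _)
  rw [Fintype.sum_unique, hookPoly_fin_one,
    Subsingleton.elim (default : Equiv.Perm (Fin 1)) 1, h, h0]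
  simp

theorem sum_hookPoly_eval_neg_one [IsDomain R] (m : ℕ) :
    ∑ σ : Equiv.Perm (Fin (m + 1)), (hookPoly R σ).eval (-1) = ((m + 1).factorial : R) := by
  have key : ∀ m : ℕ, (∑ σ : Equiv.Perm (Fin (m + 1)),
      hookPoly R σ * C ((1 : R) ^ cycleCount σ)).eval (-1) = ((m + 1).factorial : R) := by
    intro m
    induction m with
    | zero => rw [sum_hookPoly_mul_pow_cycleCount_fin_one]; simp
    | succ m ih =>
      rw [sum_hookPoly_mul_pow_cycleCount_succ, eval_sub, eval_mul, ih, Nat.factorial_succ (m + 1)]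
      simp
  rw [← key m, eval_finsetSum]
  simp

/-- The coefficients of `x ∑ det (1 + q P) / (1 + q) x ^ ℓ(σ)` as a polynomial in `q`. -/
noncomputable def hookCoeff (x : R) (m j : ℕ) : R :=
  (m.choose j : R) * (ascPochhammer R (m + 1 - j)).eval x * (descPochhammer R (j + 1)).eval x

theorem hookCoeff_succ_zero (x : R) (m : ℕ) :
    hookCoeff x (m + 1) 0 = (x + (m + 1 : ℕ)) * hookCoeff x m 0 := by
  simp only [hookCoeff, Nat.choose_zero_right, Nat.sub_zero]
  rw [ascPochhammer_succ_eval]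
  ring

/-- After the common factorial factors are removed, this is Pascal's rule. -/
theorem hookCoeff_succ_succ (x : R) (m i : ℕ) :
    hookCoeff x (m + 1) (i + 1)
      = (x + (m : R) - i) * hookCoeff x m (i + 1) + (x - 1 - i) * hookCoeff x m i := by
  simp only [hookCoeff]
  have hd := descPochhammer_succ_eval (i + 1) x
  rcases lt_trichotomy i m with h | rfl | h
  · obtain ⟨t, rfl⟩ := Nat.exists_eq_add_of_lt h
    rw [show i + t + 1 + 1 + 1 - (i + 1) = t + 2 by omega,
      show i + t + 1 + 1 - (i + 1) = t + 1 by omega, show i + t + 1 + 1 - i = t + 2 by omega,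
      hd, ascPochhammer_succ_eval (t + 1), Nat.choose_succ_succ]
    push_cast
    ring
  · rw [Nat.choose_succ_self, show i + 1 + 1 - (i + 1) = 1 by omega,
      show i + 1 - i = 1 by omega, hd]
    simp
    ring
  · rw [Nat.choose_eq_zero_of_lt (show m + 1 < i + 1 by omega),
      Nat.choose_eq_zero_of_lt (show m < i + 1 by omega), Nat.choose_eq_zero_of_lt h]
    simp

theorem coeff_C_mul_sum_hookPoly [IsDomain R] (x : R) (m j : ℕ) :
    (C x * ∑ σ : Equiv.Perm (Fin (m + 1)), hookPoly R σ * C (x ^ cycleCount σ)).coeff j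
      = hookCoeff x m j := by
  induction m generalizing j with
  | zero =>
    rw [sum_hookPoly_mul_pow_cycleCount_fin_one, ← C_mul, coeff_C, hookCoeff]
    rcases j with _ | j
    · simp
    · simp
  | succ m ih =>
    rw [sum_hookPoly_mul_pow_cycleCount_succ]
    set G := ∑ σ : Equiv.Perm (Fin (m + 1)), hookPoly R σ * C (x ^ cycleCount σ)
    have h : C x * ((C x * (1 + X) + ((m + 1 : ℕ) : R[X]) - X) * G - X * (1 + X) * derivative G)
        = C (x + (m + 1 : ℕ)) * (C x * G) + X * (C (x - 1) * (C x * G))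
          - X * derivative (C x * G) - X * (X * derivative (C x * G)) := by
      rw [derivative_mul, derivative_C]
      simp only [C_add, C_sub, C_1, map_natCast]
      ring
    rw [h]
    simp only [coeff_add, coeff_sub]
    rcases j with _ | j
    · rw [coeff_C_mul, ih, hookCoeff_succ_zero]
      simp
    · rw [coeff_X_mul, coeff_X_mul, coeff_X_mul, coeff_C_mul, coeff_C_mul _ (n := j),
        coeff_derivative, ih, ih, hookCoeff_succ_succ]
      rcases j with _ | j
      · simp
        ring
      · rw [coeff_X_mul, coeff_derivative, ih]
        push_cast
        ring

theorem sum_hookPoly_eval_mul_of_conj [IsDomain R] {f : Equiv.Perm (Fin (m + 1)) → R}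
    (hf : ∀ g σ, f (g * σ * g⁻¹) = f σ) :
    ∑ σ : Equiv.Perm (Fin (m + 1)), (hookPoly R σ).eval (-1) * f σ
      = ((m + 1).factorial : R) * f (finRotate (m + 1)) := by
  rw [← sum_hookPoly_eval_neg_one, sum_mul]
  refine Finset.sum_congr rfl fun σ _ => ?_
  by_cases h : ∀ S : Set (Fin (m + 1)), (∀ i, σ i ∈ S ↔ i ∈ S) → S.Nonempty → ¬ Sᶜ.Nonempty
  · obtain ⟨g, hg⟩ := isConj_iff.mp (isConj_finRotate_of_transitive σ h)
    rw [← hg, hf]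
  · push Not at h
    obtain ⟨S, h1, h2, h3⟩ := h
    rw [hookPoly_eval_neg_one_eq_zero R S h1 h2 h3, zero_mul, zero_mul]

theorem mul_endpointSum_finRotate [IsDomain R] (x : R) (m k : ℕ) :
    ((m + 1).factorial : R) * (2 ^ k * (x * endpointSum x k (finRotate (m + 1))))
      = ∑ j ∈ range (m + 1), (((m + 1 : ℕ) : R) * ((m : R) - 2 * (j : R))) ^ k
          * hookCoeff x m j * (-1) ^ j := by
  set G := ∑ σ : Equiv.Perm (Fin (m + 1)), hookPoly R σ * C (x ^ cycleCount σ) with hG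
  have h1 := sum_hookPoly_eval_mul_of_conj (m := m)
    (f := fun σ => 2 ^ k * endpointSum x k σ) (fun g σ => by rw [endpointSum_conj])
  have h2 := congrArg (Polynomial.eval (-1)) (sum_hookPoly_mul_endpointSum (m := m) x k)
  rw [eval_finsetSum] at h2
  simp only [eval_mul (p := hookPoly R _), eval_C] at h2
  have h3 : ∀ g : R[X], C x * (contentOp m)^[k] g = (contentOp m)^[k] (C x * g) := by
    intro g
    clear h1 h2
    induction k generalizing g with
    | zero => rfl
    | succ k ih => rw [Function.iterate_succ_apply, ih, ← contentOp_C_mul,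
        Function.iterate_succ_apply]
  -- The binomial in `hookCoeff` vanishes beyond m, so evaluation at -1 is a sum over j ≤ m.
  have h4 : ((contentOp m)^[k] (C x * G)).natDegree < m + 1 := by
    rw [Nat.lt_succ_iff, natDegree_le_iff_coeff_eq_zero]
    intro j hj
    rw [coeff_contentOp_iterate, hG, coeff_C_mul_sum_hookPoly, hookCoeff,
      Nat.choose_eq_zero_of_lt hj]
    simp
  calc _ = x * (((m + 1).factorial : R) * (2 ^ k * endpointSum x k (finRotate (m + 1)))) := by ring
    _ = ((contentOp m)^[k] (C x * G)).eval (-1) := by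
        rw [← h1, h2, ← h3, eval_mul, eval_C]
    _ = _ := by
        rw [eval_eq_sum_range' h4]
        refine Finset.sum_congr rfl fun j _ => ?_
        rw [coeff_contentOp_iterate, hG, coeff_C_mul_sum_hookPoly]

end HookSum

/-! ### Defect and endpoint of a path. -/

section Paths

variable {n k : ℕ}

theorem isPathFrom_cons {σ ρ : Equiv.Perm (Fin n)} {γ : Fin (k + 1) → Equiv.Perm (Fin n)} :
    IsPathFrom σ (Fin.cons ρ γ : Fin (k + 2) → Equiv.Perm (Fin n)) ↔
      ρ = σ ∧ (transpositionGraph n).Adj σ (γ 0) ∧ IsPathFrom (γ 0) γ := by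
  simp only [IsPathFrom, Fin.cons_zero, true_and]
  refine and_congr_right fun h => ?_
  subst h
  refine ⟨fun h => ⟨by simpa using h 0, fun i => by simpa using h i.succ⟩, fun h i => ?_⟩
  refine Fin.cases ?_ (fun i => ?_) i
  · simpa using h.1
  · simpa using h.2 i

theorem pathDefect_cons {ρ : Equiv.Perm (Fin n)} {γ : Fin (k + 1) → Equiv.Perm (Fin n)} :
    pathDefect (Fin.cons ρ γ : Fin (k + 2) → Equiv.Perm (Fin n))
      = (if permLength (γ 0) = permLength ρ + 1 then 1 else 0) + pathDefect γ := by
  rw [pathDefect, Fin.card_filter_univ_succ, pathDefect]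
  have h : ∀ i : Fin k, (Fin.cons ρ γ : Fin (k + 2) → Equiv.Perm (Fin n)) i.succ.castSucc
      = γ i.castSucc := fun i => by rw [Fin.castSucc_succ, Fin.cons_succ]
  simp only [Fin.cons_succ, Fin.castSucc_zero, Fin.cons_zero, h]
  split_ifs <;> omega

theorem cycleCount_last_add_two_mul_pathDefect {σ : Equiv.Perm (Fin n)}
    {γ : Fin (k + 1) → Equiv.Perm (Fin n)} (h : IsPathFrom σ γ) :
    cycleCount (γ (Fin.last k)) + 2 * pathDefect γ = cycleCount σ + k := by
  induction k generalizing σ with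
  | zero =>
    rw [show γ (Fin.last 0) = σ from h.1]
    simp [pathDefect]
  | succ k ih =>
    obtain ⟨ρ, γ, rfl⟩ : ∃ ρ γ', γ = Fin.cons ρ γ' := ⟨_, _, (Fin.cons_self_tail γ).symm⟩
    obtain ⟨rfl, hadj, hγ⟩ := isPathFrom_cons.mp h
    have h1 := ih hγ
    rw [← Fin.succ_last, Fin.cons_succ, pathDefect_cons]
    obtain ⟨i, j, hij, hρ⟩ := transpositionGraph_adj_iff.mp hadj
    have h2 := cycleCount_swap_mul_or ⟨i, j, hij, rfl⟩ ρ
    rw [← hρ] at h2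
    -- These bounds keep the truncated subtraction in `permLength` exact.
    have h3 := cycleCount_le ρ
    have h4 := cycleCount_le (γ 0)
    rcases h2 with h2 | h2
    · rw [if_neg (by rw [permLength, permLength]; omega)]
      omega
    · rw [if_pos (by rw [permLength, permLength]; omega)]
      omega

open Classical in
theorem endpointSum_eq_sum_paths {A : Type*} [CommRing A] (x : A) (k : ℕ)
    (σ : Equiv.Perm (Fin n)) :
    endpointSum x k σ = ∑ γ : Fin (k + 1) → Equiv.Perm (Fin n) with IsPathFrom σ γ,
      x ^ cycleCount (γ (Fin.last k)) := by
  induction k generalizing σ with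
  | zero =>
    rw [Finset.sum_eq_single (fun _ => σ)]
    · rfl
    · intro γ hγ hne
      exact absurd (funext fun i => by
        rw [show i = 0 from Subsingleton.elim (α := Fin 1) _ _, (mem_filter.mp hγ).2.1]) hne
    · intro h
      exact absurd (mem_filter.mpr ⟨mem_univ _, rfl, fun i => i.elim0⟩) h
  | succ k ih =>
    rw [endpointSum, transpositionSum]
    simp_rw [ih, Finset.sum_filter]
    rw [← Equiv.sum_comp (Fin.consEquiv fun _ => Equiv.Perm (Fin n)), Fintype.sum_prod_type_right]
    trans ∑ ρ, ∑ γ : Fin (k + 1) → Equiv.Perm (Fin n), if (transpositionGraph n).Adj σ ρ then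
      if IsPathFrom ρ γ then x ^ cycleCount (γ (Fin.last k)) else 0 else 0
    · refine Finset.sum_congr rfl fun ρ _ => ?_
      split_ifs
      · rfl
      · simp
    rw [Finset.sum_comm]
    refine Finset.sum_congr rfl fun γ _ => ?_
    rw [Finset.sum_eq_single (γ 0), Finset.sum_eq_single σ]
    · rw [← ite_and, Fin.consEquiv_apply, ← Fin.succ_last, Fin.cons_succ]
      refine if_congr ?_ rfl rfl
      exact (isPathFrom_cons.trans (and_iff_right rfl)).symm
    · intro ρ _ hne
      exact if_neg fun h => hne (isPathFrom_cons.mp h).1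
    · simp
    · intro ρ _ hne
      rw [if_neg (c := IsPathFrom ρ γ) fun h => hne h.1.symm, ite_self]
    · simp

open Polynomial in
theorem coeff_endpointSum_X (σ : Equiv.Perm (Fin n)) (t : ℕ) :
    (endpointSum (X : ℚ[X]) k σ).coeff t
      = Nat.card {γ : Fin (k + 1) → Equiv.Perm (Fin n) //
          IsPathFrom σ γ ∧ cycleCount (γ (Fin.last k)) = t} := by
  classical
  rw [endpointSum_eq_sum_paths, finsetSum_coeff]
  simp only [coeff_X_pow]
  rw [Finset.sum_boole, Finset.filter_filter, Nat.card_eq_fintype_card, Fintype.card_subtype]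
  simp only [eq_comm]

theorem cycleCount_finRotate (m : ℕ) : cycleCount (finRotate (m + 1)) = 1 := by
  rcases m with _ | m
  · have h := card_invariantColorings (finRotate 1)
    rw [show invariantColorings (finRotate 1) = univ by decide] at h
    exact (Nat.pow_right_injective (le_refl 2) (by simpa using h)).symm
  · rw [cycleCount_eq_card_cycleType_add, cycleType_finRotate, support_finRotate]
    simp

open Polynomial in
-- The endpoint has k + 1 - 2d cycles, and the extra factor X shifts the exponent by one. For t = 0
-- the endpoint would need -1 cycles, so both sides vanish.
theorem pathCount_finRotate_eq_coeff (m d t : ℕ) (h : t + 2 * d = k + 2) :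
    (pathCount (finRotate (m + 1)) k d : ℚ)
      = (X * endpointSum (X : ℚ[X]) k (finRotate (m + 1))).coeff t := by
  rcases t with _ | t
  · rw [mul_coeff_zero, coeff_X_zero, zero_mul, pathCount, Nat.cast_eq_zero]
    rw [Nat.card_eq_zero]
    refine Or.inl ⟨fun γ => ?_⟩
    have h1 := cycleCount_last_add_two_mul_pathDefect γ.2.1
    rw [γ.2.2, cycleCount_finRotate] at h1
    omega
  · rw [coeff_X_mul, coeff_endpointSum_X, pathCount]
    congr 1
    refine Nat.card_congr (Equiv.subtypeEquivRight fun γ => and_congr_right fun hγ => ?_)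
    have h1 := cycleCount_last_add_two_mul_pathDefect hγ
    rw [cycleCount_finRotate] at h1
    omega

theorem pathCount_finRotate_eq_zero (m d : ℕ) (h : k + 2 < 2 * d) :
    pathCount (finRotate (m + 1)) k d = 0 := by
  rw [pathCount, Nat.card_eq_zero]
  refine Or.inl ⟨fun γ => ?_⟩
  have h1 := cycleCount_last_add_two_mul_pathDefect γ.2.1
  rw [γ.2.2, cycleCount_finRotate] at h1
  omega

end Paths

/-! ### Stirling numbers and extraction of coefficients. -/

section Stirling
open Polynomial

theorem ascPochhammer_eval_X (N : ℕ) : (ascPochhammer ℚ[X] N).eval X = ascPochhammer ℚ N := by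
  induction N with
  | zero => simp
  | succ N ih => rw [ascPochhammer_succ_eval, ih, ascPochhammer_succ_right]

theorem descPochhammer_eval_X (N : ℕ) : (descPochhammer ℚ[X] N).eval X = descPochhammer ℚ N := by
  induction N with
  | zero => simp
  | succ N ih => rw [descPochhammer_succ_eval, ih, descPochhammer_succ_right]

theorem descPochhammer_comp_neg_X (N : ℕ) :
    (descPochhammer ℚ N).comp (-X) = (-1) ^ N * ascPochhammer ℚ N := by
  induction N with
  | zero => simp
  | succ N ih =>
    rw [descPochhammer_succ_right, mul_comp, ih, ascPochhammer_succ_right]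
    simp
    ring

/-- Rising and falling factorials are exchanged by x ↦ -x up to sign; this is the source of (-1)^l
in the formula. -/
theorem coeff_ascPochhammer_sub {N l : ℕ} (h : l ≤ N) :
    (ascPochhammer ℚ N).coeff (N - l) = (-1) ^ l * (descPochhammer ℚ N).coeff (N - l) := by
  have h1 := congrArg (fun p => p.coeff (N - l)) (descPochhammer_comp_neg_X N)
  rw [show (-X : ℚ[X]) = C (-1) * X by simp] at h1
  simp only [comp_C_mul_X_coeff] at h1
  rw [show ((-1 : ℚ[X]) ^ N) = C ((-1) ^ N) by simp, coeff_C_mul] at h1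
  obtain ⟨a, rfl⟩ := Nat.exists_eq_add_of_le h
  rw [Nat.add_sub_cancel_left, pow_add] at *
  have h2 : ((-1 : ℚ) ^ a) * (-1) ^ a = 1 := by rw [← mul_pow]; simp
  have h3 : ((-1 : ℚ) ^ l) * (-1) ^ l = 1 := by rw [← mul_pow]; simp
  linear_combination (-(-1 : ℚ) ^ l * (-1) ^ a) * h1
    + ((-1) ^ l * (descPochhammer ℚ (l + a)).coeff a
      - (-1) ^ l * (-1) ^ l * (ascPochhammer ℚ (l + a)).coeff a) * h2
    - (ascPochhammer ℚ (l + a)).coeff a * h3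

theorem signedStirlingFirst_sub_of_le {N l : ℕ} (h : l ≤ N) :
    (signedStirlingFirst N ((N : ℤ) - l) : ℚ) = (descPochhammer ℚ N).coeff (N - l) := by
  rw [signedStirlingFirst, if_neg (by omega), show ((N : ℤ) - l).toNat = N - l by omega,
    ← descPochhammer_map (Int.castRingHom ℚ), coeff_map]
  rfl

theorem signedStirlingFirst_sub_of_lt {N l : ℕ} (h : N < l) :
    signedStirlingFirst N ((N : ℤ) - l) = 0 := by
  rw [signedStirlingFirst, if_pos (by omega)]

/-- The convolution of two rows of Stirling numbers is a coefficient of a product of rising and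
falling factorials. -/
theorem sum_signedStirlingFirst_mul {N M B t : ℕ} {T : ℤ} (hT : T + t = N + M) (hB : T < B) :
    ∑ q ∈ (range B ×ˢ range B).filter (fun q : ℕ × ℕ => (q.1 : ℤ) + (q.2 : ℤ) = T),
        (-1 : ℚ) ^ q.1 * signedStirlingFirst N ((N : ℤ) - q.1)
          * signedStirlingFirst M ((M : ℤ) - q.2)
      = (ascPochhammer ℚ N * descPochhammer ℚ M).coeff t := by
  have hne : ∀ q : ℕ × ℕ, (-1 : ℚ) ^ q.1 * signedStirlingFirst N ((N : ℤ) - q.1)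
      * signedStirlingFirst M ((M : ℤ) - q.2) ≠ 0 → q.1 ≤ N ∧ q.2 ≤ M := by
    intro q hq
    constructor
    · by_contra! h
      rw [signedStirlingFirst_sub_of_lt h] at hq
      simp at hq
    · by_contra! h
      rw [signedStirlingFirst_sub_of_lt h] at hq
      simp at hq
  rw [coeff_mul]
  -- Only nonzero terms are matched: they satisfy q.1 ≤ N and q.2 ≤ M, where the natural
  -- subtractions are exact.
  refine Finset.sum_bij_ne_zero (fun q _ _ => (N - q.1, M - q.2)) ?_ ?_ ?_ ?_
  · intro q hq h
    have := hne q h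
    have := (mem_filter.mp hq).2
    rw [HasAntidiagonal.mem_antidiagonal]
    dsimp only
    omega
  · intro q hq h q' hq' h' heq
    have h1 := hne q h
    have h2 := hne q' h'
    rw [Prod.mk.injEq] at heq
    ext <;> omega
  · rintro ⟨a, b⟩ hab h
    rw [HasAntidiagonal.mem_antidiagonal] at hab
    have ha : a ≤ N := by
      by_contra! hlt
      exact h (by rw [coeff_eq_zero_of_natDegree_lt (by rwa [ascPochhammer_natDegree]), zero_mul])
    have hb : b ≤ M := by
      by_contra! hlt
      exact h (by rw [coeff_eq_zero_of_natDegree_lt (p := descPochhammer ℚ M)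
        (by rwa [descPochhammer_natDegree]), mul_zero])
    refine ⟨(N - a, M - b), ?_, ?_, ?_⟩
    · simp only [mem_filter, mem_product, mem_range] at hab ⊢
      omega
    · dsimp only at h ⊢
      rw [signedStirlingFirst_sub_of_le (Nat.sub_le _ _),
        signedStirlingFirst_sub_of_le (Nat.sub_le _ _),
        ← coeff_ascPochhammer_sub (Nat.sub_le _ _), Nat.sub_sub_self ha, Nat.sub_sub_self hb]
      exact h
    · rw [Nat.sub_sub_self ha, Nat.sub_sub_self hb]
  · intro q hq h
    have h1 := hne q h
    rw [coeff_ascPochhammer_sub h1.1, signedStirlingFirst_sub_of_le h1.1,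
      signedStirlingFirst_sub_of_le h1.2]

theorem signedStirlingFirst_mul_eq_zero {N M : ℕ} {q : ℕ × ℕ} (h : N + M < q.1 + q.2) :
    (signedStirlingFirst N ((N : ℤ) - q.1) : ℚ) * signedStirlingFirst M ((M : ℤ) - q.2) = 0 := by
  rcases Nat.lt_or_ge N q.1 with h1 | h1
  · rw [signedStirlingFirst_sub_of_lt h1]
    simp
  · rw [signedStirlingFirst_sub_of_lt (show M < q.2 by omega)]
    simp

theorem factorial_mul_coeff_endpointSum (m k t : ℕ) :
    ((m + 1).factorial : ℚ)
        * (2 ^ k * (X * endpointSum (X : ℚ[X]) k (finRotate (m + 1))).coeff t)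
      = ∑ p ∈ antidiagonal m, (((m + 1 : ℕ) : ℚ) * ((p.2 : ℚ) - p.1)) ^ k * (m.choose p.1 : ℚ)
          * (-1) ^ p.1 * (ascPochhammer ℚ (p.2 + 1) * descPochhammer ℚ (p.1 + 1)).coeff t := by
  have h := congrArg (fun p => p.coeff t) (mul_endpointSum_finRotate (X : ℚ[X]) m k)
  simp only [finsetSum_coeff] at h
  rw [show ((m + 1).factorial : ℚ[X]) = C ((m + 1).factorial : ℚ) by simp,
    show (2 : ℚ[X]) ^ k = C (2 ^ k) by simp [show (C 2 : ℚ[X]) = 2 from map_ofNat C 2],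
    coeff_C_mul, coeff_C_mul] at h
  rw [h, Finset.Nat.sum_antidiagonal_eq_sum_range_succ_mk]
  refine Finset.sum_congr rfl fun j hj => ?_
  have hj' : j ≤ m := Nat.lt_succ_iff.mp (mem_range.mp hj)
  have e : (((m + 1 : ℕ) : ℚ[X]) * ((m : ℚ[X]) - 2 * (j : ℚ[X]))) ^ k * hookCoeff X m j * (-1) ^ j
      = C ((((m + 1 : ℕ) : ℚ) * (((m - j : ℕ) : ℚ) - j)) ^ k * (m.choose j : ℚ) * (-1) ^ j)
        * (ascPochhammer ℚ (m - j + 1) * descPochhammer ℚ (j + 1)) := by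
    rw [hookCoeff, ascPochhammer_eval_X, descPochhammer_eval_X,
      show m + 1 - j = m - j + 1 by omega, Nat.cast_sub hj']
    simp only [C_mul, C_pow, C_sub, map_natCast, C_neg, C_1]
    ring
  rw [e, coeff_C_mul]

end Stirling

/-! ### The path-count formula. -/

/-- The box of side n + 2d loses nothing, since l + m = n - 1 - k + 2d < n + 2d; a negative total
makes the filter empty. -/
theorem mainTheorem6 (n k d : ℕ) (hn : 1 ≤ n) :
    (pathCount (finRotate n) k d : ℚ) =
      1 / (n : ℚ) *
        ∑ p ∈ antidiagonal (n - 1),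
          ∑ q ∈ (range (n + 2 * d) ×ˢ range (n + 2 * d)).filter
              (fun q : ℕ × ℕ => (q.1 : ℤ) + (q.2 : ℤ) = (n : ℤ) - 1 - (k : ℤ) + 2 * (d : ℤ)),
            (-1 : ℚ) ^ (q.1 + p.1) / ((p.1.factorial : ℚ) * (p.2.factorial : ℚ)) *
              ((n : ℚ) / 2 * ((p.2 : ℚ) - (p.1 : ℚ))) ^ k *
              (signedStirlingFirst (p.2 + 1) ((p.2 : ℤ) + 1 - (q.1 : ℤ)) : ℚ) *
              (signedStirlingFirst (p.1 + 1) ((p.1 : ℤ) + 1 - (q.2 : ℤ)) : ℚ) := by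
  obtain ⟨m, rfl⟩ := Nat.exists_eq_add_of_le' hn
  rw [Nat.add_sub_cancel]
  rcases Nat.lt_or_ge (k + 2) (2 * d) with hlt | hge
  -- Here l + m exceeds n + 1 = (r + 1) + (s + 1), so one Stirling number in every term has a
  -- negative index.
  · rw [pathCount_finRotate_eq_zero m d hlt, Finset.sum_eq_zero, mul_zero, Nat.cast_zero]
    intro p hp
    refine Finset.sum_eq_zero fun q hq => ?_
    rw [HasAntidiagonal.mem_antidiagonal] at hp
    have h1 := (mem_filter.mp hq).2
    have h2 := signedStirlingFirst_mul_eq_zero (N := p.2 + 1) (M := p.1 + 1) (q := q) (by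
      push_cast at h1
      omega)
    push_cast at h2
    rw [mul_assoc _ (signedStirlingFirst _ _ : ℚ), h2, mul_zero]
  · obtain ⟨t, ht⟩ := Nat.exists_eq_add_of_le' hge
    rw [pathCount_finRotate_eq_coeff m d t ht.symm]
    have hfac : ((m + 1).factorial : ℚ) ≠ 0 := Nat.cast_ne_zero.mpr (Nat.factorial_ne_zero _)
    have h2k : (2 : ℚ) ^ k ≠ 0 := by positivity
    apply mul_left_cancel₀ h2k
    apply mul_left_cancel₀ hfac
    rw [factorial_mul_coeff_endpointSum, mul_sum, mul_sum, mul_sum]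
    refine Finset.sum_congr rfl fun p hp => ?_
    rw [HasAntidiagonal.mem_antidiagonal] at hp
    rw [← sum_signedStirlingFirst_mul (N := p.2 + 1) (M := p.1 + 1) (t := t)
      (B := m + 1 + 2 * d) (T := ((m + 1 : ℕ) : ℤ) - 1 - (k : ℤ) + 2 * (d : ℤ))
      (by push_cast; omega) (by push_cast; omega), mul_sum, mul_sum, mul_sum, mul_sum]
    refine Finset.sum_congr rfl fun q _ => ?_
    -- Dividing the binomial by (m + 1)! leaves 1/(n r! s!), the prefactor in the formula.
    have hch : (m.choose p.1 : ℚ) * p.1.factorial * p.2.factorial = m.factorial := by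
      rw [← hp]
      rw [Nat.choose_symm_add]
      exact_mod_cast Nat.add_choose_mul_factorial_mul_factorial p.1 p.2
    have hr : (p.1.factorial : ℚ) ≠ 0 := Nat.cast_ne_zero.mpr (Nat.factorial_ne_zero _)
    have hs : (p.2.factorial : ℚ) ≠ 0 := Nat.cast_ne_zero.mpr (Nat.factorial_ne_zero _)
    have hm : ((m + 1 : ℕ) : ℚ) ≠ 0 := Nat.cast_ne_zero.mpr (Nat.succ_ne_zero m)
    rw [Nat.factorial_succ, Nat.cast_mul, ← hch, mul_pow _ _ k, mul_pow _ _ k, div_pow, pow_add]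
    push_cast at hm ⊢
    field_simp
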